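/- Let $\mathcal{CN}(0,\sigma^2)$ denote the law of a complex random variable whose real and imaginary parts are independent $\mathcal N(0,\sigma^2/2)$ random variables. Let $h_A\sim\mathcal{CN}(0,\sigma^2)$ and $h_B\sim\mathcal{CN}(0,\sigma^2)$ be jointly Gaussian, i.e. the real random vector $(\Re h_A,\Im h_A,\Re h_B,\Im h_B)$ is Gaussian. Let $I(\cdot\,;\cdot)\in[0,\infty]$ denote mutual information, that is, the Kullback--Leibler divergence of the joint law from the product of the marginal laws, and let $\Phi_h$ denote the phase (argument) of $h$. (i) If $\operatorname{Cov}(\Re h_A,\Im h_B)=\operatorname{Cov}(\Im h_A,\Re h_B)=0$ (as holds, for instance, when $h_A=h+n_A$ and $h_B=h+n_B$ with $h\sim\mathcal{CN}(0,\sigma_h^2)$ and $n_A,n_B\sim\mathcal{CN}(0,\sigma_W^2)$ independent and $\sigma^2=\sigma_h^2+\sigma_W^2$), then $$I(h_A;h_B)=I(\Re h_A;\Re h_B)+I(\Im h_A;\Im h_B).$$ (ii) Whether or not these covariances vanish, $$I(h_A;h_B)\ \ge\ I(|h_A|;|h_B|)+I(\Phi_{h_A};\Phi_{h_B}).$$ 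-/

import Mathlib

open MeasureTheory ProbabilityTheory

open scoped ENNReal NNReal

/-- The mutual information `I(X; Y)` of two random elements (in nats): the Kullback-Leibler
divergence of the joint law from the product of the marginal laws. -/
noncomputable def mutualInfo {Ω α β : Type*} [MeasurableSpace Ω] [MeasurableSpace α]
    [MeasurableSpace β] (X : Ω → α) (Y : Ω → β) (P : Measure Ω) : ℝ≥0∞ :=
  InformationTheory.klDiv (P.map (fun ω => (X ω, Y ω))) ((P.map X).prod (P.map Y))

/-- The complex Gaussian law `CN(m, v)` with mean `m` and variance `v`: the real and imaginary
parts are independent real Gaussians with means `m.re` and `m.im` and variance `v / 2` each. -/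
noncomputable def complexGaussian (m : ℂ) (v : ℝ≥0) : Measure ℂ :=
  ((gaussianReal m.re (v / 2)).prod (gaussianReal m.im (v / 2))).map
    Complex.measurableEquivRealProd.symm

open InformationTheory

section KullbackLeibler

variable {α β : Type*} [MeasurableSpace α] [MeasurableSpace β]

/-! Under a centred circular Gaussian law, `re` and `im` are independent, and so are modulus and
argument, since the density is radial. In either coordinate system the product of the laws of `hA`
and `hB` therefore regroups as a product of two reference measures, one per coordinate. Data
processing and superadditivity of divergence against a product then give `≥`
(`mutualInfo_comp_add_mutualInfo_comp_le`), which is all of (ii) and half of (i). For equality in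
(i), vanishing covariances and joint Gaussianity make the pair of real parts independent of the pair
of imaginary parts. The joint law is then a product too, and divergence between products is
additive. -/

theorem klDiv_map_measurableEquiv (e : α ≃ᵐ β) (μ ν : Measure α) [IsFiniteMeasure μ]
    [IsFiniteMeasure ν] : klDiv (μ.map e) (ν.map e) = klDiv μ ν := by
  refine le_antisymm (klDiv_map_le μ ν e.measurable) ?_
  have h := klDiv_map_le (μ.map e) (ν.map e) e.symm.measurable
  simpa [Measure.map_map e.symm.measurable e.measurable] using h

theorem klDiv_prod_prod (μ₁ ν₁ : Measure α) (μ₂ ν₂ : Measure β) [IsProbabilityMeasure μ₁]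
    [IsProbabilityMeasure ν₁] [IsProbabilityMeasure μ₂] [IsProbabilityMeasure ν₂] :
    klDiv (μ₁.prod μ₂) (ν₁.prod ν₂) = klDiv μ₁ ν₁ + klDiv μ₂ ν₂ := by
  -- The chain rule leaves a term with common first factor `μ₁`; swapping makes it a common kernel,
  -- which cancels.
  have hswap : klDiv (μ₁.prod μ₂) (μ₁.prod ν₂) = klDiv (μ₂.prod μ₁) (ν₂.prod μ₁) := by
    rw [← klDiv_map_measurableEquiv MeasurableEquiv.prodComm (μ₁.prod μ₂)]
    congr 1 <;> exact Measure.prod_swap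
  have h := klDiv_compProd_eq_add μ₁ ν₁ (Kernel.const α μ₂) (Kernel.const α ν₂)
  have h' := klDiv_compProd_left μ₂ ν₂ (Kernel.const β μ₁)
  simp only [Measure.compProd_const] at h h'
  rw [h, hswap, h']

/-- The Kullback-Leibler divergence with respect to a product measure is superadditive. -/
theorem klDiv_fst_add_klDiv_snd_le [StandardBorelSpace β] [Nonempty β] (μ : Measure (α × β))
    (ν₁ : Measure α) (ν₂ : Measure β) [IsProbabilityMeasure μ] [IsProbabilityMeasure ν₁]
    [IsProbabilityMeasure ν₂] :
    klDiv μ.fst ν₁ + klDiv μ.snd ν₂ ≤ klDiv μ (ν₁.prod ν₂) := by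
  -- Chain rule along the disintegration of `μ`; projecting the conditional term to the second
  -- coordinate can only decrease it.
  have h := klDiv_compProd_eq_add μ.fst ν₁ μ.condKernel (Kernel.const α ν₂)
  rw [μ.disintegrate μ.condKernel] at h
  simp only [Measure.compProd_const] at h
  rw [h]
  gcongr
  have h' := klDiv_map_le μ (μ.fst.prod ν₂) measurable_snd
  rwa [Measure.map_snd_prod, measure_univ, one_smul] at h'

end KullbackLeibler

section Product

variable {α β γ δ : Type*} [MeasurableSpace α] [MeasurableSpace β] [MeasurableSpace γ]
  [MeasurableSpace δ]

theorem map_prodProdProdComm_prod (a : Measure α) (b : Measure β) (c : Measure γ) (d : Measure δ)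
    [SFinite a] [SFinite b] [SFinite c] [SFinite d] :
    ((a.prod b).prod (c.prod d)).map (fun p => ((p.1.1, p.2.1), (p.1.2, p.2.2))) =
      (a.prod c).prod (b.prod d) := by
  refine Measure.ext_of_lintegral _ fun f hf => ?_
  rw [lintegral_map hf (by fun_prop), lintegral_prod _ (by fun_prop),
    lintegral_prod _ (by fun_prop), lintegral_prod _ (by fun_prop), lintegral_prod _ (by fun_prop)]
  refine lintegral_congr fun x => ?_
  have h1 : ∀ y, ∫⁻ q, f ((x, q.1), (y, q.2)) ∂(c.prod d) =
      ∫⁻ z, ∫⁻ w, f ((x, z), (y, w)) ∂d ∂c := fun y => lintegral_prod _ (by fun_prop)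
  have h2 : ∀ z, ∫⁻ q, f ((x, z), q) ∂(b.prod d) =
      ∫⁻ y, ∫⁻ w, f ((x, z), (y, w)) ∂d ∂b := fun z => lintegral_prod _ (by fun_prop)
  simp only [h1, h2]
  exact lintegral_lintegral_swap (by fun_prop)

theorem map_prod_of_indepFun {E F : Type*} [MeasurableSpace E] [MeasurableSpace F]
    {μ : Measure E} {ν : Measure F} [IsProbabilityMeasure μ] [IsProbabilityMeasure ν]
    {f : E → α} {g : E → β} {f' : F → γ} {g' : F → δ} (hf : Measurable f) (hg : Measurable g)
    (hf' : Measurable f') (hg' : Measurable g') (h : IndepFun f g μ) (h' : IndepFun f' g' ν) :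
    (μ.prod ν).map (fun p => ((f p.1, f' p.2), (g p.1, g' p.2))) =
      ((μ.map f).prod (ν.map f')).prod ((μ.map g).prod (ν.map g')) := by
  rw [← map_prodProdProdComm_prod, ← h.map_prod_eq_prod_map_map hf.aemeasurable hg.aemeasurable,
    ← h'.map_prod_eq_prod_map_map hf'.aemeasurable hg'.aemeasurable,
    Measure.map_prod_map _ _ (hf.prodMk hg) (hf'.prodMk hg'),
    Measure.map_map (by fun_prop) (by fun_prop)]
  rfl

end Product

section MutualInformation

variable {Ω E F α β γ δ : Type*} [MeasurableSpace Ω] [MeasurableSpace E] [MeasurableSpace F]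
  [MeasurableSpace α] [MeasurableSpace β] [MeasurableSpace γ] [MeasurableSpace δ]
  {P : Measure Ω} [IsProbabilityMeasure P] {X : Ω → E} {Y : Ω → F}
  {f : E → α} {g : E → β} {f' : F → γ} {g' : F → δ}

/-- If the components `f X`, `g X` are independent, and so are `f' Y`, `g' Y`, then the mutual
information of `X` and `Y` is at least the sum of the componentwise mutual informations. -/
theorem mutualInfo_comp_add_mutualInfo_comp_le [StandardBorelSpace β] [Nonempty β]
    [StandardBorelSpace δ] [Nonempty δ] (hX : AEMeasurable X P) (hY : AEMeasurable Y P)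
    (hf : Measurable f) (hg : Measurable g) (hf' : Measurable f') (hg' : Measurable g')
    (h : IndepFun f g (P.map X)) (h' : IndepFun f' g' (P.map Y)) :
    mutualInfo (fun ω => f (X ω)) (fun ω => f' (Y ω)) P +
      mutualInfo (fun ω => g (X ω)) (fun ω => g' (Y ω)) P ≤ mutualInfo X Y P := by
  have := Measure.isProbabilityMeasure_map hX
  have := Measure.isProbabilityMeasure_map hY
  have := Measure.isProbabilityMeasure_map (hX.prodMk hY)
  have := Measure.isProbabilityMeasure_map (μ := P.map X) hf.aemeasurable
  have := Measure.isProbabilityMeasure_map (μ := P.map X) hg.aemeasurable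
  have := Measure.isProbabilityMeasure_map (μ := P.map Y) hf'.aemeasurable
  have := Measure.isProbabilityMeasure_map (μ := P.map Y) hg'.aemeasurable
  let e : E × F → (α × γ) × (β × δ) := fun p => ((f p.1, f' p.2), (g p.1, g' p.2))
  have he : Measurable e := by fun_prop
  have := Measure.isProbabilityMeasure_map (μ := P.map fun ω => (X ω, Y ω)) he.aemeasurable
  have h1 := klDiv_map_le (P.map fun ω => (X ω, Y ω)) ((P.map X).prod (P.map Y)) he
  rw [map_prod_of_indepFun hf hg hf' hg' h h'] at h1
  refine le_trans (le_of_eq ?_) ((klDiv_fst_add_klDiv_snd_le _ _ _).trans h1)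
  unfold mutualInfo
  rw [Measure.fst, Measure.snd, AEMeasurable.map_map_of_aemeasurable (by fun_prop) (by fun_prop),
    AEMeasurable.map_map_of_aemeasurable (by fun_prop) (by fun_prop),
    AEMeasurable.map_map_of_aemeasurable (by fun_prop) (by fun_prop),
    AEMeasurable.map_map_of_aemeasurable (by fun_prop) (by fun_prop),
    AEMeasurable.map_map_of_aemeasurable (by fun_prop) (by fun_prop),
    AEMeasurable.map_map_of_aemeasurable (by fun_prop) (by fun_prop),
    AEMeasurable.map_map_of_aemeasurable (by fun_prop) (by fun_prop),
    AEMeasurable.map_map_of_aemeasurable (by fun_prop) (by fun_prop)]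
  rfl

end MutualInformation

section Polar

/-- The modulus and the argument are independent under a law with a radial density. -/
theorem indepFun_norm_arg_withDensity {φ : ℝ → ℝ≥0∞} (hφ : Measurable φ)
    [IsProbabilityMeasure ((volume : Measure ℂ).withDensity fun z => φ ‖z‖)] :
    IndepFun (fun z : ℂ => ‖z‖) Complex.arg
      ((volume : Measure ℂ).withDensity fun z => φ ‖z‖) := by
  set μ := (volume : Measure ℂ).withDensity fun z => φ ‖z‖ with hμ
  -- The factor `r` is the polar Jacobian. Neither measure is normalised: only the product of their
  -- masses is 1. The ray `arg = π` is null, so the open interval suffices.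
  let m₁ : Measure ℝ := (volume.restrict (Set.Ioi 0)).withDensity fun r => ENNReal.ofReal r * φ r
  let m₂ : Measure ℝ := volume.restrict (Set.Ioo (-Real.pi) Real.pi)
  have hmap : μ.map (fun z => (‖z‖, Complex.arg z)) = m₁.prod m₂ := by
    refine Measure.ext_of_lintegral _ fun f hf => ?_
    rw [lintegral_map hf (by fun_prop), hμ,
      lintegral_withDensity_eq_lintegral_mul _ (by fun_prop) (by fun_prop),
      ← Complex.lintegral_comp_polarCoord_symm,
      prod_withDensity_left (by fun_prop), Measure.prod_restrict,
      lintegral_withDensity_eq_lintegral_mul _ (by fun_prop) hf]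
    refine setLIntegral_congr_fun polarCoord.open_target.measurableSet fun p hp => ?_
    have h := Complex.polarCoord.right_inv (x := p) hp
    rw [Complex.polarCoord_apply, Prod.ext_iff] at h
    simp only [Pi.mul_apply, smul_eq_mul] at h ⊢
    rw [h.1, h.2, mul_assoc]
  have hrect : ∀ s t, MeasurableSet s → MeasurableSet t →
      μ ((fun z : ℂ => ‖z‖) ⁻¹' s ∩ Complex.arg ⁻¹' t) = m₁ s * m₂ t := by
    intro s t hs ht
    rw [← Measure.prod_prod, ← hmap, Measure.map_apply (by fun_prop) (hs.prod ht)]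
    rfl
  rw [indepFun_iff_measure_inter_preimage_eq_mul]
  intro s t hs ht
  have h1 := hrect s Set.univ hs .univ
  have h2 := hrect Set.univ t .univ ht
  have h3 := hrect Set.univ Set.univ .univ .univ
  simp only [Set.preimage_univ, Set.inter_univ, Set.univ_inter, measure_univ] at h1 h2 h3
  rw [hrect s t hs ht, h1, h2,
    show m₁ s * m₂ Set.univ * (m₁ Set.univ * m₂ t) =
      m₁ s * m₂ t * (m₁ Set.univ * m₂ Set.univ) by ring, ← h3, mul_one]

end Polar

section ComplexGaussian

instance isProbabilityMeasure_complexGaussian (m : ℂ) (v : ℝ≥0) :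
    IsProbabilityMeasure (complexGaussian m v) :=
  Measure.isProbabilityMeasure_map (by fun_prop)

theorem indepFun_re_im_complexGaussian (m : ℂ) (v : ℝ≥0) :
    IndepFun Complex.re Complex.im (complexGaussian m v) := by
  have h : (fun z : ℂ => (z.re, z.im)) = Complex.measurableEquivRealProd := rfl
  rw [indepFun_iff_map_prod_eq_prod_map_map (by fun_prop) (by fun_prop), h]
  have hre : (complexGaussian m v).map Complex.re = gaussianReal m.re (v / 2) := by
    rw [complexGaussian, Measure.map_map (by fun_prop) (by fun_prop)]
    exact measurePreserving_fst.map_eq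
  have him : (complexGaussian m v).map Complex.im = gaussianReal m.im (v / 2) := by
    rw [complexGaussian, Measure.map_map (by fun_prop) (by fun_prop)]
    exact measurePreserving_snd.map_eq
  rw [hre, him, complexGaussian, MeasurableEquiv.map_map_symm]

theorem complexGaussian_zero_var (m : ℂ) : complexGaussian m 0 = Measure.dirac m := by
  simp [complexGaussian, gaussianReal_zero_var, Measure.dirac_prod_dirac]

theorem complexGaussian_zero_eq_withDensity {v : ℝ≥0} (hv : v ≠ 0) :
    complexGaussian 0 v = (volume : Measure ℂ).withDensity fun z =>
      ENNReal.ofReal ((√(2 * Real.pi * (v / 2 : ℝ≥0)))⁻¹ ^ 2 *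
        Real.exp (-‖z‖ ^ 2 / (2 * (v / 2 : ℝ≥0)))) := by
  have hv' : v / 2 ≠ 0 := by positivity
  refine Measure.ext_of_lintegral _ fun f hf => ?_
  rw [complexGaussian, lintegral_map hf (by fun_prop), Complex.zero_re, Complex.zero_im,
    gaussianReal_of_var_ne_zero _ hv', prod_withDensity (by fun_prop) (by fun_prop),
    lintegral_withDensity_eq_lintegral_mul _ (by fun_prop) (by fun_prop),
    lintegral_withDensity_eq_lintegral_mul _ (by fun_prop) hf,
    ← Complex.volume_preserving_equiv_real_prod.symm.lintegral_comp (by fun_prop)]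
  refine lintegral_congr fun p => ?_
  simp only [Pi.mul_apply]
  congr 1
  rw [gaussianPDF, gaussianPDF, ← ENNReal.ofReal_mul (gaussianPDFReal_nonneg _ _ _),
    Complex.sq_norm, Complex.normSq_apply, gaussianPDFReal, gaussianPDFReal, mul_mul_mul_comm,
    ← Real.exp_add, ← sq]
  congr 3
  simp
  ring

theorem indepFun_norm_arg_complexGaussian (v : ℝ≥0) :
    IndepFun (fun z : ℂ => ‖z‖) Complex.arg (complexGaussian 0 v) := by
  rcases eq_or_ne v 0 with rfl | hv
  -- With zero variance there is no density, but under a Dirac mass any two measurable maps are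
  -- independent.
  · rw [complexGaussian_zero_var]
    rw [indepFun_iff_measure_inter_preimage_eq_mul]
    intro s t hs ht
    have hs' := measurable_norm (α := ℂ) hs
    have ht' := Complex.measurable_arg ht
    rw [Measure.dirac_apply' _ (hs'.inter ht'), Measure.dirac_apply' _ hs',
      Measure.dirac_apply' _ ht', Set.inter_indicator_one, Pi.mul_apply]
  · have hprob := isProbabilityMeasure_complexGaussian 0 v
    rw [complexGaussian_zero_eq_withDensity hv] at hprob ⊢
    exact indepFun_norm_arg_withDensity (φ := fun r => ENNReal.ofReal
      ((√(2 * Real.pi * (v / 2 : ℝ≥0)))⁻¹ ^ 2 * Real.exp (-r ^ 2 / (2 * (v / 2 : ℝ≥0)))))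
      (by fun_prop)

end ComplexGaussian

section JointlyGaussian

variable {Ω : Type*} [MeasurableSpace Ω] {P : Measure Ω} {X Y : Ω → ℂ}

/-- Two complex random variables whose real parts are jointly independent of their imaginary
parts have additive mutual information. -/
theorem mutualInfo_complex_eq_add [IsProbabilityMeasure P] (hX : AEMeasurable X P) (hY : AEMeasurable Y P)
    (hXind : IndepFun Complex.re Complex.im (P.map X))
    (hYind : IndepFun Complex.re Complex.im (P.map Y))
    (h : IndepFun (fun ω => ((X ω).re, (Y ω).re)) (fun ω => ((X ω).im, (Y ω).im)) P) :
    mutualInfo X Y P = mutualInfo (fun ω => (X ω).re) (fun ω => (Y ω).re) P +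
      mutualInfo (fun ω => (X ω).im) (fun ω => (Y ω).im) P := by
  refine le_antisymm ?_ (mutualInfo_comp_add_mutualInfo_comp_le hX hY (by fun_prop) (by fun_prop)
    (by fun_prop) (by fun_prop) hXind hYind)
  have hXre : AEMeasurable (fun ω => (X ω).re) P := by fun_prop
  have hXim : AEMeasurable (fun ω => (X ω).im) P := by fun_prop
  have hYre : AEMeasurable (fun ω => (Y ω).re) P := by fun_prop
  have hYim : AEMeasurable (fun ω => (Y ω).im) P := by fun_prop
  have := Measure.isProbabilityMeasure_map hX
  have := Measure.isProbabilityMeasure_map hY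
  have := Measure.isProbabilityMeasure_map hXre
  have := Measure.isProbabilityMeasure_map hXim
  have := Measure.isProbabilityMeasure_map hYre
  have := Measure.isProbabilityMeasure_map hYim
  have := Measure.isProbabilityMeasure_map (hXre.prodMk hYre)
  have := Measure.isProbabilityMeasure_map (hXim.prodMk hYim)
  -- Reassembling the complex pair from its real and imaginary pairs gives the reverse bound by data
  -- processing.
  let e : (ℝ × ℝ) × (ℝ × ℝ) → ℂ × ℂ := fun p => (⟨p.1.1, p.2.1⟩, ⟨p.1.2, p.2.2⟩)
  have he : Measurable e := by
    have hmk : Measurable fun q : ℝ × ℝ => (⟨q.1, q.2⟩ : ℂ) :=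
      Complex.measurableEquivRealProd.symm.measurable
    exact (hmk.comp (by fun_prop : Measurable fun p : (ℝ × ℝ) × (ℝ × ℝ) => (p.1.1, p.2.1))).prodMk
      (hmk.comp (by fun_prop : Measurable fun p : (ℝ × ℝ) × (ℝ × ℝ) => (p.1.2, p.2.2)))
  unfold mutualInfo
  rw [← klDiv_prod_prod, ← h.map_prod_eq_prod_map_map (hXre.prodMk hYre) (hXim.prodMk hYim)]
  refine le_trans (le_of_eq ?_) (klDiv_map_le _ _ he)
  congr 1
  · rw [AEMeasurable.map_map_of_aemeasurable (by fun_prop) (by fun_prop)]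
    rfl
  · have hprod := map_prod_of_indepFun (μ := P.map X) (ν := P.map Y) (by fun_prop) (by fun_prop)
      (by fun_prop) (by fun_prop) hXind hYind
    rw [AEMeasurable.map_map_of_aemeasurable (by fun_prop) hX,
      AEMeasurable.map_map_of_aemeasurable (by fun_prop) hY,
      AEMeasurable.map_map_of_aemeasurable (by fun_prop) hX,
      AEMeasurable.map_map_of_aemeasurable (by fun_prop) hY] at hprod
    simp only [Function.comp_def] at hprod
    rw [← hprod, Measure.map_map he (by fun_prop)]
    exact Measure.map_id.symm

theorem covariance_re_im_eq_zero [IsProbabilityMeasure P] {m : ℂ} {v : ℝ≥0}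
    (hX : HasLaw X (complexGaussian m v) P)
    (hXg : HasGaussianLaw X P) :
    cov[fun ω => (X ω).re, fun ω => (X ω).im; P] = 0 := by
  have h : IndepFun (fun ω => (X ω).re) (fun ω => (X ω).im) P := by
    have := indepFun_re_im_complexGaussian m v
    rw [← hX.map_eq, indepFun_iff_map_prod_eq_prod_map_map (by fun_prop) (by fun_prop)] at this
    rw [indepFun_iff_map_prod_eq_prod_map_map (by fun_prop) (by fun_prop)]
    simpa only [AEMeasurable.map_map_of_aemeasurable (Measurable.aemeasurable Complex.measurable_re)
        hX.aemeasurable,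
      AEMeasurable.map_map_of_aemeasurable (Measurable.aemeasurable Complex.measurable_im)
        hX.aemeasurable,
      AEMeasurable.map_map_of_aemeasurable (Measurable.aemeasurable
        (Complex.measurable_re.prodMk Complex.measurable_im)) hX.aemeasurable] using! this
  exact h.covariance_eq_zero (hXg.map_fun Complex.reCLM).memLp_two
    (hXg.map_fun Complex.imCLM).memLp_two

/-- Jointly Gaussian blocks are independent once all cross-covariances vanish; `Fin 2` vectors fit
the coordinatewise criterion. -/
theorem indepFun_re_re_im_im (h : HasGaussianLaw (fun ω => (X ω, Y ω)) P)
    (hXX : cov[fun ω => (X ω).re, fun ω => (X ω).im; P] = 0)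
    (hXY : cov[fun ω => (X ω).re, fun ω => (Y ω).im; P] = 0)
    (hYX : cov[fun ω => (Y ω).re, fun ω => (X ω).im; P] = 0)
    (hYY : cov[fun ω => (Y ω).re, fun ω => (Y ω).im; P] = 0) :
    IndepFun (fun ω => ((X ω).re, (Y ω).re)) (fun ω => ((X ω).im, (Y ω).im)) P := by
  let U : Fin 2 → Ω → ℝ := ![fun ω => (X ω).re, fun ω => (Y ω).re]
  let V : Fin 2 → Ω → ℝ := ![fun ω => (X ω).im, fun ω => (Y ω).im]
  let L : (ℂ × ℂ) →L[ℝ] (Fin 2 → ℝ) × (Fin 2 → ℝ) :=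
    (ContinuousLinearMap.pi ![Complex.reCLM ∘L .fst ℝ ℂ ℂ, Complex.reCLM ∘L .snd ℝ ℂ ℂ]).prod
      (ContinuousLinearMap.pi ![Complex.imCLM ∘L .fst ℝ ℂ ℂ, Complex.imCLM ∘L .snd ℝ ℂ ℂ])
  have hUV : HasGaussianLaw (fun ω => (fun i => U i ω, fun j => V j ω)) P := by
    have hL : (fun ω => (fun i => U i ω, fun j => V j ω)) = fun ω => L (X ω, Y ω) := by
      ext ω i <;> fin_cases i <;> rfl
    rw [hL]
    exact h.map_fun L
  have hind := hUV.indepFun_of_covariance_eval (by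
    intro i j
    fin_cases i <;> fin_cases j <;> assumption)
  exact hind.comp (φ := fun u : Fin 2 → ℝ => (u 0, u 1)) (ψ := fun u : Fin 2 → ℝ => (u 0, u 1))
    (by fun_prop) (by fun_prop)

end JointlyGaussian

theorem theorem1 {Ω : Type*} [MeasurableSpace Ω] (P : Measure Ω) [IsProbabilityMeasure P]
    (σ : ℝ≥0) (hA hB : Ω → ℂ)
    (hA_law : HasLaw hA (complexGaussian 0 (σ ^ 2)) P)
    (hB_law : HasLaw hB (complexGaussian 0 (σ ^ 2)) P)
    (h_joint : HasGaussianLaw (fun ω => (hA ω, hB ω)) P) :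
    (cov[fun ω => (hA ω).re, fun ω => (hB ω).im; P] = 0 →
      cov[fun ω => (hA ω).im, fun ω => (hB ω).re; P] = 0 →
      mutualInfo hA hB P =
        mutualInfo (fun ω => (hA ω).re) (fun ω => (hB ω).re) P +
          mutualInfo (fun ω => (hA ω).im) (fun ω => (hB ω).im) P) ∧
    mutualInfo (fun ω => ‖hA ω‖) (fun ω => ‖hB ω‖) P +
        mutualInfo (fun ω => (hA ω).arg) (fun ω => (hB ω).arg) P ≤
      mutualInfo hA hB P := by
  have hA_gauss : HasGaussianLaw hA P := h_joint.fst
  have hB_gauss : HasGaussianLaw hB P := h_joint.snd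
  have hA_meas := hA_law.aemeasurable
  have hB_meas := hB_law.aemeasurable
  refine ⟨fun h₁ h₂ => ?_, ?_⟩
  · refine mutualInfo_complex_eq_add hA_meas hB_meas ?_ ?_ ?_
    · rw [hA_law.map_eq]
      exact indepFun_re_im_complexGaussian _ _
    · rw [hB_law.map_eq]
      exact indepFun_re_im_complexGaussian _ _
    · exact indepFun_re_re_im_im h_joint (covariance_re_im_eq_zero hA_law hA_gauss) h₁
        ((covariance_comm _ _).trans h₂) (covariance_re_im_eq_zero hB_law hB_gauss)
  · refine mutualInfo_comp_add_mutualInfo_comp_le hA_meas hB_meas measurable_norm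
      Complex.measurable_arg measurable_norm Complex.measurable_arg ?_ ?_
    · rw [hA_law.map_eq]
      exact indepFun_norm_arg_complexGaussian _
    · rw [hB_law.map_eq]
      exact indepFun_norm_arg_complexGaussian _
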